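/- Let $\mathsf{k}$ be a field. \emph{Affine circuits} over $\mathsf{k}$, of sort $(n,m)$ ($n$ left ports, $m$ right ports), are the terms built by sequential composition $c\,;d$ and monoidal product $c\oplus d$ from the empty circuit, the wire, the symmetry (crossing), the left-to-right generators copy $(1,2)$, delete $(1,0)$, scalar $r\in\mathsf{k}$ $(1,1)$, register $(1,1)$, add $(2,1)$, zero $(0,1)$, one $(0,1)$, and the mirror images of these generators. A circuit $c$ of sort $(n,m)$ denotes a relation $[\![c]\!]\subseteq \mathsf{k}(x)^n\times\mathsf{k}(x)^m$: copy, delete, add, zero have the evident meaning, scalar $r$ is $\{(p,pr)\}$, the register is $\{(p,px)\}$, one is $\{(\bullet,1)\}$, mirror images denote converse relations, $;$ is relational composition and $\oplus$ is the product. Circuits are \emph{equivalent} if they denote the same relation. A circuit is \emph{linear} (a circuit of $\mathsf{Circ}$) if it contains neither one nor its mirror image. An \emph{affine signal flow graph} is a circuit built from the empty circuit, wires, symmetries and all left-to-right generators by $;$, $\oplus$ and feedback through a register, $\mathrm{Tr}(c)$, which for $c$ of sort $(n+1,m+1)$ connects a right port of $c$ through a register to a left port of $c$. A \emph{signal flow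 graph} is the same without the generator one. A \emph{rewiring} of a circuit is obtained by partitioning its ports into inputs and outputs and bending (with cups and caps) and crossing wires so that the inputs, in any order, are on the left and the outputs, in any order, are on the right. A circuit is \emph{realisable} if some rewiring of it is equivalent to an affine signal flow graph. A port $p$ of a linear circuit $d$ is an \emph{input port} if there is a signal flow graph $f$ such that $d$ is equivalent to a rewiring of $f$ in which $p$ comes from a left port of $f$. For an affine circuit $c$ of sort $(n,m)$, let $\hat c$ be a linear circuit of sort $(n+1,m)$ that one obtains by passing from $c$ to an equivalent circuit $c'$ with exactly one occurrence of the generator one and no occurrence of its mirror image, and replacing that occurrence by a wire that runs to a new port on the left boundary. \textbf{Theorem.} For every affine circuit $c$ such a circuit $\hat c$ exists, and for every choice of $\hat c$: $c$ is realisable if and only if the new port of $\hat c$ (the one to which the generator one was connected) is an input port of $\hat c$. -/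

import Mathlib

universe u

namespace SignalFlow

/-- The left-to-right generators of the affine signal flow calculus over `k`;
`Gen k n m` has `n` ports on the left and `m` ports on the right. -/
inductive Gen (k : Type u) : ℕ → ℕ → Type u
  | copy : Gen k 1 2
  | delete : Gen k 1 0
  | scalar (r : k) : Gen k 1 1
  | register : Gen k 1 1
  | add : Gen k 2 1
  | zero : Gen k 0 1
  | one : Gen k 0 1

/-- The number of occurrences of `one` in a generator. -/
def Gen.oneCount {k : Type u} : {n m : ℕ} → Gen k n m → ℕ
  | _, _, .one => 1
  | _, _, .copy | _, _, .delete | _, _, .scalar _ | _, _, .register | _, _, .add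
  | _, _, .zero => 0

/-- Circuits of the affine signal flow calculus, of sort `(n, m)`. A generator `g` may be used as
it is (`gen g`) or reflected about the vertical axis (`coGen g`); `seq` is sequential composition
and `par` is the monoidal product. -/
inductive ACirc (k : Type u) : ℕ → ℕ → Type u
  | gen {n m : ℕ} (g : Gen k n m) : ACirc k n m
  | coGen {n m : ℕ} (g : Gen k n m) : ACirc k m n
  | empty : ACirc k 0 0
  | wire : ACirc k 1 1
  | sym : ACirc k 2 2
  | seq {n z m : ℕ} (c : ACirc k n z) (d : ACirc k z m) : ACirc k n m
  | par {n m r z : ℕ} (c : ACirc k n m) (d : ACirc k r z) : ACirc k (n + r) (m + z)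

/-! ### Denotational semantics: relations over the field of polynomial fractions -/

section Denotation

variable {k : Type u} [Field k]

/-- The relation over `k(x)` denoted by a generator. -/
noncomputable def Gen.den : {n m : ℕ} → Gen k n m →
    Set ((Fin n → RatFunc k) × (Fin m → RatFunc k))
  | _, _, .copy => Set.range fun p : RatFunc k => (![p], ![p, p])
  | _, _, .delete => Set.range fun p : RatFunc k => (![p], ![])
  | _, _, .scalar r => Set.range fun p : RatFunc k => (![p], ![p * RatFunc.C r])
  | _, _, .register => Set.range fun p : RatFunc k => (![p], ![p * RatFunc.X])
  | _, _, .add => Set.range fun p : RatFunc k × RatFunc k => (![p.1, p.2], ![p.1 + p.2])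
  | _, _, .zero => {(![], ![0])}
  | _, _, .one => {(![], ![1])}

/-- The relation over `k(x)` denoted by a circuit. -/
noncomputable def ACirc.den : {n m : ℕ} → ACirc k n m →
    Set ((Fin n → RatFunc k) × (Fin m → RatFunc k))
  | _, _, .gen g => g.den
  | _, _, .coGen g => {p | p.swap ∈ g.den}
  | _, _, .empty => {(![], ![])}
  | _, _, .wire => Set.range fun p : RatFunc k => (![p], ![p])
  | _, _, .sym => Set.range fun p : RatFunc k × RatFunc k => (![p.1, p.2], ![p.2, p.1])
  | _, _, .seq c d => {p | ∃ v, (p.1, v) ∈ c.den ∧ (v, p.2) ∈ d.den}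
  | _, _, .par c d => {p | ∃ q ∈ c.den, ∃ q' ∈ d.den,
      p = (Fin.append q.1 q'.1, Fin.append q.2 q'.2)}

/-- Two circuits of the same sort are equivalent if they denote the same relation. -/
def ACirc.Equivalent {n m : ℕ} (c d : ACirc k n m) : Prop := c.den = d.den

end Denotation

namespace ACirc

variable {k : Type u}

/-! ### Derived circuits -/

/-- Transport of a circuit along equalities of its numbers of ports. -/
def cast {n m n' m' : ℕ} (hn : n = n') (hm : m = m') (c : ACirc k n m) : ACirc k n' m' :=
  hn ▸ hm ▸ c

/-- `n` parallel wires. -/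
def idn : (n : ℕ) → ACirc k n n
  | 0 => .empty
  | n + 1 => .par (idn n) .wire

/-- A wire bent so that both its ends are on the right. -/
def cup : ACirc k 0 2 := .seq (.coGen .delete) (.gen .copy)

/-- A wire bent so that both its ends are on the left. -/
def cap : ACirc k 2 0 := .seq (.coGen .copy) (.gen .delete)

/-- The wire at position `i` is moved to the last position; the others keep their order. -/
def toLast : (n : ℕ) → Fin (n + 1) → ACirc k (n + 1) (n + 1)
  | 0, _ => .wire
  | n + 1, i => Fin.lastCases (motive := fun _ => ACirc k (n + 1 + 1) (n + 1 + 1))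
      (idn (n + 1 + 1))
      (fun j => .seq (.par (toLast n j) .wire) (.par (n := n) (m := n) (idn n) .sym)) i

/-- The circuit of crossing wires whose `j`-th right port is connected to its `σ j`-th
left port. -/
def perm : (n m : ℕ) → (Fin m ≃ Fin n) → ACirc k n m
  | 0, 0, _ => .empty
  | 0, _ + 1, σ => (σ 0).elim0
  | _ + 1, 0, σ => (σ.symm 0).elim0
  | n + 1, m + 1, σ =>
      .seq (toLast n (σ (Fin.last m)))
        (.par (perm n m (Equiv.removeNone
          ((finSuccEquivLast.symm.trans σ).trans (finSuccEquiv' (σ (Fin.last m)))))) .wire)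

/-- The last of `r + 1` wires is moved to the first position; the others keep their order. -/
def lastToFirst : (r : ℕ) → ACirc k (r + 1) (1 + r)
  | 0 => .wire
  | r + 1 => .seq (.par (n := r) (m := r) (idn r) .sym)
      (.par (n := r + 1) (m := 1 + r) (lastToFirst r) .wire)

/-! ### Rewiring -/

/-- The last left port is bent to the right, where it becomes the last port. -/
def bendRight {n m : ℕ} (c : ACirc k (n + 1) m) : ACirc k n (m + 1) :=
  .seq (.par (n := n) (m := n) (idn n) cup) (.par (n := n + 1) c .wire)

/-- The last right port is bent to the left, where it becomes the last port. -/
def bendLeft {n m : ℕ} (c : ACirc k n (m + 1)) : ACirc k (n + 1) m :=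
  .seq (.par (m := m + 1) c .wire) (.par (n := m) (m := m) (idn m) cap)

/-- All left ports are bent to the right, one after the other. -/
def bendAllRight : (n : ℕ) → {m : ℕ} → ACirc k n m → ACirc k 0 (m + n)
  | 0, _, c => c
  | n + 1, m, c => cast rfl (by omega) (bendAllRight n (bendRight c))

/-- The last `i` right ports are bent to the left, one after the other. -/
def bendManyLeft : (i : ℕ) → {n m : ℕ} → ACirc k n (m + i) → ACirc k (n + i) m
  | 0, _, _, c => c
  | i + 1, n, m, c => cast (by omega) rfl
      (bendManyLeft i (n := n + 1) (bendLeft (m := m + i) c))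

/-- The position of each port of a circuit of sort `(n, m)` after all left ports have been bent
to the right by `bendAllRight`: the right ports come first, in order, and then the left ports, in
reversed order. -/
def layout (n m : ℕ) : Fin n ⊕ Fin m ≃ Fin (m + n) :=
  ((Equiv.sumComm (Fin n) (Fin m)).trans
    (Equiv.sumCongr (Equiv.refl (Fin m)) Fin.revPerm)).trans finSumFinEquiv

/-- The rewiring of a circuit `c` of sort `(n, m)` along a bijection `e` from its ports to the
ports of the sort `(i, o)`: a port that `e` sends to `Sum.inl` becomes a left port (an input) and
a port that `e` sends to `Sum.inr` becomes a right port (an output). Wires are only bent (by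
`cup` and `cap`) and crossed. -/
def rewire {n m i o : ℕ} (c : ACirc k n m) (e : Fin n ⊕ Fin m ≃ Fin i ⊕ Fin o) : ACirc k i o :=
  cast (Nat.zero_add i) rfl
    (bendManyLeft i (.seq (bendAllRight n c)
      (perm (m + n) (o + i) (((layout i o).symm.trans e.symm).trans (layout n m)))))

/-! ### Linear circuits and signal flow graphs -/

/-- The circuit is built without the generator `one` and its reflection. -/
def IsLinear : {n m : ℕ} → ACirc k n m → Prop
  | _, _, .gen g => g.oneCount = 0
  | _, _, .coGen g => g.oneCount = 0
  | _, _, .empty => True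
  | _, _, .wire => True
  | _, _, .sym => True
  | _, _, .seq c d => c.IsLinear ∧ d.IsLinear
  | _, _, .par c d => c.IsLinear ∧ d.IsLinear

/-- Feedback through a register: the last right port is connected, through a register, to the
last left port. -/
def trace {n m : ℕ} (c : ACirc k (n + 1) (m + 1)) : ACirc k n m :=
  .seq (.par (n := n) (m := n) (idn n) cup)
    (.seq (.par (n := n + 1) (m := n + 1) (.par (idn n) (.gen .register)) .wire)
      (.seq (.par (n := n + 1) (m := m + 1) c .wire)
        (.par (n := m) (m := m) (idn m) cap)))

/-- Affine signal flow graphs: circuits built from all left-to-right generators by composition,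
monoidal product and feedback through a register. -/
inductive IsASF : {n m : ℕ} → ACirc k n m → Prop
  | gen {n m : ℕ} (g : Gen k n m) : IsASF (.gen g)
  | empty : IsASF .empty
  | wire : IsASF .wire
  | sym : IsASF .sym
  | seq {n z m : ℕ} {c : ACirc k n z} {d : ACirc k z m} : IsASF c → IsASF d → IsASF (.seq c d)
  | par {n m r z : ℕ} {c : ACirc k n m} {d : ACirc k r z} :
      IsASF c → IsASF d → IsASF (.par c d)
  | trace {n m : ℕ} {c : ACirc k (n + 1) (m + 1)} : IsASF c → IsASF (trace c)

/-- Signal flow graphs: as affine signal flow graphs, but without the generator `one`. -/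
inductive IsSF : {n m : ℕ} → ACirc k n m → Prop
  | gen {n m : ℕ} (g : Gen k n m) (hg : g.oneCount = 0) : IsSF (.gen g)
  | empty : IsSF .empty
  | wire : IsSF .wire
  | sym : IsSF .sym
  | seq {n z m : ℕ} {c : ACirc k n z} {d : ACirc k z m} : IsSF c → IsSF d → IsSF (.seq c d)
  | par {n m r z : ℕ} {c : ACirc k n m} {d : ACirc k r z} :
      IsSF c → IsSF d → IsSF (.par c d)
  | trace {n m : ℕ} {c : ACirc k (n + 1) (m + 1)} : IsSF c → IsSF (trace c)

end ACirc

/-- The circuits of the (linear) signal flow calculus: those without `one` and its reflection. -/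
def Circ (k : Type u) (n m : ℕ) : Type u := {c : ACirc k n m // c.IsLinear}

/-- A port of a linear circuit is an input port if the circuit has a realisation (a signal flow
graph `f` of which it is, up to equivalence, a rewiring) in which this port is an input, that
is, comes from a left port of `f`. -/
def Circ.IsInputPort {k : Type u} [Field k] {n m : ℕ} (c : Circ k n m) (p : Fin n ⊕ Fin m) :
    Prop :=
  ∃ (i o : ℕ) (f : ACirc k i o) (e : Fin i ⊕ Fin o ≃ Fin n ⊕ Fin m),
    f.IsSF ∧ c.1.Equivalent (f.rewire e) ∧ ∃ j : Fin i, e (Sum.inl j) = p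

namespace ACirc

/-- A circuit is realisable if some rewiring of it is equivalent to an affine signal flow
graph. -/
def Realisable {k : Type u} [Field k] {n m : ℕ} (c : ACirc k n m) : Prop :=
  ∃ (i o : ℕ) (e : Fin n ⊕ Fin m ≃ Fin i ⊕ Fin o) (g : ACirc k i o),
    g.IsASF ∧ (c.rewire e).Equivalent g

variable {k : Type u}

/-- The number of occurrences of the generator `one`. -/
def oneCount : {n m : ℕ} → ACirc k n m → ℕ
  | _, _, .gen g => g.oneCount
  | _, _, .coGen _ => 0
  | _, _, .empty => 0
  | _, _, .wire => 0
  | _, _, .sym => 0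
  | _, _, .seq c d => c.oneCount + d.oneCount
  | _, _, .par c d => c.oneCount + d.oneCount

/-- The number of occurrences of the reflection of the generator `one`. -/
def coOneCount : {n m : ℕ} → ACirc k n m → ℕ
  | _, _, .gen _ => 0
  | _, _, .coGen g => g.oneCount
  | _, _, .empty => 0
  | _, _, .wire => 0
  | _, _, .sym => 0
  | _, _, .seq c d => c.coOneCount + d.coOneCount
  | _, _, .par c d => c.coOneCount + d.coOneCount

/-- The replacement of the generator `one` by a wire to the left boundary. (The other generators
are given an irrelevant value.) -/
def genReplaceOne : {n m : ℕ} → Gen k n m → ACirc k (n + 1) m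
  | _, _, .one => .wire
  | _, _, .copy => .par (.gen .copy) (.gen .delete)
  | _, _, .delete => .par (.gen .delete) (.gen .delete)
  | _, _, .scalar r => .par (.gen (.scalar r)) (.gen .delete)
  | _, _, .register => .par (.gen .register) (.gen .delete)
  | _, _, .add => .par (.gen .add) (.gen .delete)
  | _, _, .zero => .par (.gen .zero) (.gen .delete)

/-- For a circuit with exactly one occurrence of `one`: that occurrence is replaced by a wire
which runs to the left boundary, where it becomes the last port. (Circuits with another number of
occurrences are given an irrelevant value.) -/
def replaceOne : {n m : ℕ} → ACirc k n m → ACirc k (n + 1) m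
  | _, _, .gen g => genReplaceOne g
  | _, _, .coGen g => .par (.coGen g) (.gen .delete)
  | _, _, .empty => .par .empty (.gen .delete)
  | _, _, .wire => .par .wire (.gen .delete)
  | _, _, .sym => .par .sym (.gen .delete)
  | _, _, .seq c d =>
      if c.oneCount = 1 then .seq c.replaceOne d
      else .seq (.par c .wire) d.replaceOne
  | _, _, .par (n := n) (r := r) c d =>
      if c.oneCount = 1 then
        .seq (.par (n := n) (m := n) (idn n) (lastToFirst r))
          (cast (Nat.add_assoc n 1 r) rfl (.par c.replaceOne d))
      else .par (n := n) (r := r + 1) c d.replaceOne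

/-- `d` is a linear circuit obtained from `c` by passing to an equivalent circuit with exactly
one `one` and no reflected `one`, and replacing that `one` by a wire to the left boundary. -/
def IsHat [Field k] {n m : ℕ} (c : ACirc k n m) (d : Circ k (n + 1) m) : Prop :=
  ∃ c' : ACirc k n m, c.Equivalent c' ∧ c'.oneCount = 1 ∧ c'.coOneCount = 0 ∧ d.1 = c'.replaceOne

end ACirc

end SignalFlow

/-!
Over `K = k(x)`, a circuit denotes an affine relation and a linear circuit a linear one, and the
replacement of the only `one` by a port turns an affine relation `A` into a linear relation `L` of
which `A` is the slice where the new port has the value `1` (`mem_den_replaceOne`). The proof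
compares rewirings and signal flow graphs through such slices. A rewiring only renames the ports of
a relation (`mem_den_rewire`), so the positions of the ports play no role.

Such a replacement exists for every circuit: `homog` gives all subcircuits one common additional
port, which feeds all occurrences of `one` and of its reflection; this port is then connected to a
single `one`.

If the new port comes from a left port of a signal flow graph which realises `L`, then connecting
`one` to this left port gives an affine signal flow graph which realises `A`
(`IsSF.exists_isASF_holds_iff`).

Conversely, if an affine signal flow graph realises `A`, then its homogenisation is a signal flow
graph with one more left port whose slice at `1` is `A` up to the names of the ports
(`IsASF.exists_isSF`). It denotes a linear relation, and so does the circuit with the new port; two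
linear relations with the same slice at `1` are equal if this slice is not empty
(`eq_of_forall_mem_iff_of_eq_one`). The slice is not empty because an affine signal flow graph
denotes a total relation (`IsASF.exists_regularAffine`): its outputs can be chosen to be affine
functions of its inputs whose coefficients are rational functions without a pole at `0`, and these
form a ring in which every `1 - x * d` is invertible, so that feedback through a register can be
resolved.
-/

namespace SignalFlow

namespace ACirc

section Denotations

variable {k : Type u} [Field k]

/-! ### Denotations of compositions and of basic wirings -/

theorem mem_den_seq {n z m : ℕ} {c : ACirc k n z} {d : ACirc k z m}
    {v : Fin n → RatFunc k} {w : Fin m → RatFunc k} :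
    (v, w) ∈ (seq c d).den ↔ ∃ u, (v, u) ∈ c.den ∧ (u, w) ∈ d.den := Iff.rfl

theorem mem_den_par {n m r z : ℕ} {c : ACirc k n m} {d : ACirc k r z}
    {v : Fin (n + r) → RatFunc k} {w : Fin (m + z) → RatFunc k} :
    (v, w) ∈ (par c d).den ↔
      (fun i => v (Fin.castAdd r i), fun j => w (Fin.castAdd z j)) ∈ c.den ∧
      (fun i => v (Fin.natAdd n i), fun j => w (Fin.natAdd m j)) ∈ d.den := by
  constructor
  · rintro ⟨⟨v₁, w₁⟩, h₁, ⟨v₂, w₂⟩, h₂, h⟩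
    obtain ⟨rfl, rfl⟩ := Prod.mk.inj h
    simpa using ⟨h₁, h₂⟩
  · rintro ⟨h₁, h₂⟩
    refine ⟨_, h₁, _, h₂, ?_⟩
    simp only [Fin.append_castAdd_natAdd]

theorem mem_den_cast {n m n' m' : ℕ} {hn : n = n'} {hm : m = m'} {c : ACirc k n m}
    {v : Fin n' → RatFunc k} {w : Fin m' → RatFunc k} :
    (v, w) ∈ (cast hn hm c).den ↔
      (fun i => v (Fin.cast hn i), fun j => w (Fin.cast hm j)) ∈ c.den := by
  subst hn hm
  rfl

theorem mem_den_empty {v w : Fin 0 → RatFunc k} : (v, w) ∈ (empty : ACirc k 0 0).den := by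
  have h : (v, w) = (![], ![]) := Prod.ext (Subsingleton.elim _ _) (Subsingleton.elim _ _)
  rw [h]
  exact Set.mem_singleton _

theorem mem_den_wire {v w : Fin 1 → RatFunc k} :
    (v, w) ∈ (wire : ACirc k 1 1).den ↔ v 0 = w 0 := by
  constructor
  · rintro ⟨p, h⟩
    obtain ⟨rfl, rfl⟩ := Prod.mk.inj h
    rfl
  · intro h
    refine ⟨v 0, Prod.ext ?_ ?_⟩ <;> ext i <;> fin_cases i <;> simp [h]

theorem mem_den_sym {v w : Fin 2 → RatFunc k} :
    (v, w) ∈ (sym : ACirc k 2 2).den ↔ w 0 = v 1 ∧ w 1 = v 0 := by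
  constructor
  · rintro ⟨p, h⟩
    obtain ⟨rfl, rfl⟩ := Prod.mk.inj h
    exact ⟨rfl, rfl⟩
  · rintro ⟨h₀, h₁⟩
    refine ⟨(v 0, v 1), Prod.ext ?_ ?_⟩ <;> ext i <;> fin_cases i <;> simp [h₀, h₁]

theorem mem_den_copy {v : Fin 1 → RatFunc k} {w : Fin 2 → RatFunc k} :
    (v, w) ∈ (gen .copy : ACirc k 1 2).den ↔ w 0 = v 0 ∧ w 1 = v 0 := by
  constructor
  · rintro ⟨p, h⟩
    obtain ⟨rfl, rfl⟩ := Prod.mk.inj h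
    exact ⟨rfl, rfl⟩
  · rintro ⟨h₀, h₁⟩
    refine ⟨v 0, Prod.ext ?_ ?_⟩ <;> ext i <;> fin_cases i <;> simp [h₀, h₁]

theorem mem_den_delete {v : Fin 1 → RatFunc k} {w : Fin 0 → RatFunc k} :
    (v, w) ∈ (gen .delete : ACirc k 1 0).den :=
  ⟨v 0, Prod.ext (by ext i; fin_cases i; rfl) (Subsingleton.elim _ _)⟩

theorem mem_den_register {v w : Fin 1 → RatFunc k} :
    (v, w) ∈ (gen .register : ACirc k 1 1).den ↔ w 0 = v 0 * RatFunc.X := by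
  constructor
  · rintro ⟨p, h⟩
    obtain ⟨rfl, rfl⟩ := Prod.mk.inj h
    rfl
  · intro h
    refine ⟨v 0, Prod.ext ?_ ?_⟩ <;> ext i <;> fin_cases i <;> simp [h]

theorem mem_den_one {v : Fin 0 → RatFunc k} {w : Fin 1 → RatFunc k} :
    (v, w) ∈ (gen .one : ACirc k 0 1).den ↔ w 0 = 1 := by
  constructor
  · intro h
    obtain ⟨rfl, rfl⟩ := Prod.mk.inj (Set.mem_singleton_iff.1 h)
    rfl
  · intro h
    exact Set.mem_singleton_iff.2 (Prod.ext (Subsingleton.elim _ _)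
      (by ext i; fin_cases i; simp [h]))

theorem mem_den_coGen {n m : ℕ} {g : Gen k n m} {v : Fin m → RatFunc k}
    {w : Fin n → RatFunc k} : (v, w) ∈ (coGen g).den ↔ (w, v) ∈ (gen g).den := Iff.rfl

theorem mem_den_cup {v : Fin 0 → RatFunc k} {w : Fin 2 → RatFunc k} :
    (v, w) ∈ (cup : ACirc k 0 2).den ↔ w 0 = w 1 := by
  rw [cup, mem_den_seq]
  constructor
  · rintro ⟨u, -, h⟩
    rw [mem_den_copy] at h
    rw [h.1, h.2]
  · intro h
    exact ⟨fun _ => w 0, mem_den_coGen.2 mem_den_delete, mem_den_copy.2 ⟨rfl, h.symm⟩⟩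

theorem mem_den_cap {v : Fin 2 → RatFunc k} {w : Fin 0 → RatFunc k} :
    (v, w) ∈ (cap : ACirc k 2 0).den ↔ v 0 = v 1 := by
  rw [cap, mem_den_seq]
  constructor
  · rintro ⟨u, h, -⟩
    have h' := mem_den_copy.1 (mem_den_coGen.1 h)
    rw [h'.1, h'.2]
  · intro h
    exact ⟨fun _ => v 0, mem_den_coGen.2 (mem_den_copy.2 ⟨rfl, h.symm⟩), mem_den_delete⟩

theorem mem_den_par_wire {n m : ℕ} {c : ACirc k n m}
    {v : Fin (n + 1) → RatFunc k} {w : Fin (m + 1) → RatFunc k} :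
    (v, w) ∈ (par c wire).den ↔
      (Fin.init v, Fin.init w) ∈ c.den ∧ v (Fin.last n) = w (Fin.last m) := by
  rw [mem_den_par, mem_den_wire]
  rfl

theorem mem_den_par_delete {n m : ℕ} {c : ACirc k n m}
    {v : Fin (n + 1) → RatFunc k} {w : Fin m → RatFunc k} :
    (v, w) ∈ (par (z := 0) c (gen .delete)).den ↔ (Fin.init v, w) ∈ c.den := by
  rw [mem_den_par]
  exact and_iff_left mem_den_delete

theorem mem_den_idn : ∀ {n : ℕ} {v w : Fin n → RatFunc k}, (v, w) ∈ (idn n).den ↔ v = w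
  | 0, _, _ => iff_of_true mem_den_empty (Subsingleton.elim _ _)
  | n + 1, v, w => by
    rw [idn, mem_den_par_wire, mem_den_idn, ← Fin.snoc_init_self v, ← Fin.snoc_init_self w,
      Fin.snoc_inj]
    simp

theorem mem_den_idn_par {n r z : ℕ} {d : ACirc k r z}
    {v : Fin (n + r) → RatFunc k} {w : Fin (n + z) → RatFunc k} :
    (v, w) ∈ (par (idn n) d).den ↔
      (∀ i, v (Fin.castAdd r i) = w (Fin.castAdd z i)) ∧
      (fun i => v (Fin.natAdd n i), fun j => w (Fin.natAdd n j)) ∈ d.den := by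
  rw [mem_den_par, mem_den_idn, funext_iff]

/-! ### Denotations of permutations and rewirings -/

theorem mem_den_idn_par_sym {n : ℕ} {v w : Fin (n + 2) → RatFunc k} :
    (v, w) ∈ (par (n := n) (m := n) (idn n) sym).den ↔
      (∀ i : Fin n, v i.castSucc.castSucc = w i.castSucc.castSucc) ∧
      w (Fin.last n).castSucc = v (Fin.last (n + 1)) ∧
      w (Fin.last (n + 1)) = v (Fin.last n).castSucc := by
  rw [mem_den_idn_par, mem_den_sym]
  rfl

theorem mem_den_toLast : ∀ {n : ℕ} {i : Fin (n + 1)} {v w : Fin (n + 1) → RatFunc k},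
    (v, w) ∈ (toLast n i).den ↔ (∀ j : Fin n, w j.castSucc = v (i.succAbove j)) ∧
      w (Fin.last n) = v i
  | 0, i, v, w => by
    rw [toLast, mem_den_wire, Fin.fin_one_eq_zero i, eq_comm]
    exact (and_iff_right fun j => j.elim0).symm
  | n + 1, i, v, w => by
    induction i using Fin.lastCases with
    | last =>
      simp only [toLast, Fin.lastCases_last, mem_den_idn, Fin.succAbove_last]
      constructor
      · rintro rfl
        simp
      · rintro ⟨h, h'⟩
        ext i
        induction i using Fin.lastCases with
        | last => rw [h']
        | cast i => rw [h]
    | cast j =>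
      simp only [toLast, Fin.lastCases_castSucc, mem_den_seq, mem_den_par_wire, mem_den_toLast,
        mem_den_idn_par_sym]
      constructor
      · rintro ⟨u, ⟨⟨h₁, h₂⟩, h₃⟩, h₄, h₅, h₆⟩
        refine ⟨fun i => ?_, ?_⟩
        · induction i using Fin.lastCases with
          | last => simpa using h₅.trans h₃.symm
          | cast i =>
            rw [Fin.castSucc_succAbove_castSucc, ← h₄]
            exact h₁ i
        · rw [h₆]
          exact h₂
      · rintro ⟨h₁, h₂⟩
        refine ⟨Fin.snoc (Fin.snoc (fun i => v (j.succAbove i).castSucc) (v j.castSucc))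
          (v (Fin.last _)), ?_, ?_⟩
        · simp [Fin.init]
        · simp [h₁, h₂]

theorem mem_den_perm : ∀ {n m : ℕ} {σ : Fin m ≃ Fin n} {v : Fin n → RatFunc k}
    {w : Fin m → RatFunc k}, (v, w) ∈ (perm n m σ).den ↔ ∀ j, w j = v (σ j)
  | 0, 0, σ, v, w => by
    rw [perm]
    exact iff_of_true mem_den_empty fun j => j.elim0
  | 0, m + 1, σ, v, w => (σ 0).elim0
  | n + 1, 0, σ, v, w => (σ.symm 0).elim0
  | n + 1, m + 1, σ, v, w => by
    -- `τ` is `σ` with the last right port and its partner removed.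
    set τ := Equiv.removeNone
      ((finSuccEquivLast.symm.trans σ).trans (finSuccEquiv' (σ (Fin.last m)))) with hτ
    have key : ∀ j : Fin m, (σ (Fin.last m)).succAbove (τ j) = σ j.castSucc := by
      intro j
      obtain ⟨i, hi⟩ := Fin.exists_succAbove_eq (x := σ j.castSucc) (y := σ (Fin.last m))
        (σ.injective.ne (Fin.castSucc_lt_last j).ne)
      have h : some (τ j) = some i := by
        rw [hτ, Equiv.removeNone_some _ ⟨i, by simp [← hi]⟩]
        simp [← hi]
      rw [Option.some.inj h, hi]
    rw [perm, mem_den_seq]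
    simp only [mem_den_toLast, mem_den_par_wire, ← hτ, mem_den_perm]
    constructor
    · rintro ⟨u, ⟨h₁, h₂⟩, h₃, h₄⟩ j
      induction j using Fin.lastCases with
      | last => rw [← h₄, h₂]
      | cast j =>
        have := h₃ j
        simp only [Fin.init] at this
        rw [this, h₁, key]
    · intro h
      refine ⟨Fin.snoc (fun i => v ((σ (Fin.last m)).succAbove i)) (v (σ (Fin.last m))), ?_, ?_⟩
      · simp
      · simp [Fin.init, h, key]

theorem mem_den_lastToFirst : ∀ {r : ℕ} {v : Fin (r + 1) → RatFunc k}
    {w : Fin (1 + r) → RatFunc k}, (v, w) ∈ (lastToFirst r).den ↔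
      w (Fin.castAdd r 0) = v (Fin.last r) ∧ ∀ i, w (Fin.natAdd 1 i) = v i.castSucc
  | 0, v, w => by
    rw [lastToFirst, mem_den_wire, eq_comm, iff_comm]
    exact and_iff_left fun i => i.elim0
  | r + 1, v, w => by
    simp only [lastToFirst, mem_den_seq]
    constructor
    · rintro ⟨u, h₁, h₂⟩
      obtain ⟨h₃, h₄, h₅⟩ := mem_den_idn_par_sym.1 h₁
      obtain ⟨h₆, h₇⟩ := mem_den_par_wire.1 h₂
      obtain ⟨h₈, h₉⟩ := mem_den_lastToFirst.1 h₆
      refine ⟨h₈.trans h₄, fun i => ?_⟩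
      induction i using Fin.lastCases with
      | last => exact h₇.symm.trans h₅
      | cast i => exact (h₉ i).trans (h₃ i).symm
    · rintro ⟨h₁, h₂⟩
      refine ⟨Fin.snoc (Fin.snoc (fun i => v i.castSucc.castSucc) (v (Fin.last _)))
        (v (Fin.last _).castSucc), ?_, ?_⟩
      · rw [mem_den_idn_par_sym]
        simp
      · refine mem_den_par_wire.2 ⟨mem_den_lastToFirst.2 ⟨?_, fun i => ?_⟩, ?_⟩
        · exact Eq.trans h₁ (by simp [Fin.init])
        · simpa [Fin.init] using h₂ i.castSucc
        · simpa using (h₂ (Fin.last r)).symm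

theorem mem_den_idn_par_cup {n : ℕ} {v : Fin n → RatFunc k} {w : Fin (n + 2) → RatFunc k} :
    (v, w) ∈ (par (n := n) (m := n) (idn n) cup).den ↔
      (∀ i : Fin n, v i = w i.castSucc.castSucc) ∧
      w (Fin.last n).castSucc = w (Fin.last (n + 1)) := by
  refine mem_den_idn_par.trans ?_
  rw [mem_den_cup]
  rfl

theorem mem_den_idn_par_cap {n : ℕ} {v : Fin (n + 2) → RatFunc k} {w : Fin n → RatFunc k} :
    (v, w) ∈ (par (n := n) (m := n) (idn n) cap).den ↔
      (∀ i : Fin n, v i.castSucc.castSucc = w i) ∧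
      v (Fin.last n).castSucc = v (Fin.last (n + 1)) := by
  refine mem_den_idn_par.trans ?_
  rw [mem_den_cap]
  rfl

theorem mem_den_idn_par_register {n : ℕ} {v w : Fin (n + 1) → RatFunc k} :
    (v, w) ∈ (par (idn n) (gen .register)).den ↔
      (∀ i : Fin n, v i.castSucc = w i.castSucc) ∧ w (Fin.last n) = v (Fin.last n) * RatFunc.X := by
  rw [mem_den_idn_par, mem_den_register]
  rfl

/-- An equation with a tuple extended by a last entry, read entry by entry. -/
theorem eq_snoc_iff {n : ℕ} {K : Type*} {u : Fin (n + 1) → K} {v : Fin n → K} {a : K} :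
    u = Fin.snoc v a ↔ (∀ i : Fin n, u i.castSucc = v i) ∧ u (Fin.last n) = a := by
  constructor
  · rintro rfl
    simp
  · rintro ⟨h₁, h₂⟩
    ext i
    induction i using Fin.lastCases with
    | last => rw [h₂, Fin.snoc_last]
    | cast i => rw [h₁, Fin.snoc_castSucc]

theorem mem_den_bendRight {n m : ℕ} {c : ACirc k (n + 1) m} {v : Fin n → RatFunc k}
    {w : Fin (m + 1) → RatFunc k} : (v, w) ∈ (bendRight c).den ↔
      ((Fin.snoc v (w (Fin.last m)) : Fin (n + 1) → RatFunc k), Fin.init w) ∈ c.den := by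
  simp only [bendRight, mem_den_seq]
  constructor
  · rintro ⟨u, h₁, h₂⟩
    obtain ⟨h₃, h₄⟩ := mem_den_idn_par_cup.1 h₁
    obtain ⟨h₅, h₆⟩ := mem_den_par_wire.1 h₂
    rwa [(eq_snoc_iff (u := Fin.init u)).2 ⟨fun i => (h₃ i).symm, h₄.trans h₆⟩] at h₅
  · intro h
    exact ⟨Fin.snoc (Fin.snoc v (w (Fin.last m)) : Fin (n + 1) → RatFunc k) (w (Fin.last m)),
      mem_den_idn_par_cup.2 (by simp), mem_den_par_wire.2 (by simpa using h)⟩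

theorem mem_den_bendLeft {n m : ℕ} {c : ACirc k n (m + 1)} {v : Fin (n + 1) → RatFunc k}
    {w : Fin m → RatFunc k} : (v, w) ∈ (bendLeft c).den ↔
      (Fin.init v, (Fin.snoc w (v (Fin.last n)) : Fin (m + 1) → RatFunc k)) ∈ c.den := by
  simp only [bendLeft, mem_den_seq]
  constructor
  · rintro ⟨u, h₁, h₂⟩
    obtain ⟨h₃, h₄⟩ := mem_den_idn_par_cap.1 h₂
    obtain ⟨h₅, h₆⟩ := mem_den_par_wire.1 h₁
    rwa [(eq_snoc_iff (u := Fin.init u)).2 ⟨h₃, h₄.trans h₆.symm⟩] at h₅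
  · intro h
    exact ⟨Fin.snoc (Fin.snoc w (v (Fin.last n)) : Fin (m + 1) → RatFunc k) (v (Fin.last n)),
      mem_den_par_wire.2 (by simpa using h), mem_den_idn_par_cap.2 (by simp)⟩

theorem mem_den_bendAllRight : ∀ {n m : ℕ} {c : ACirc k n m} {v : Fin 0 → RatFunc k}
    {w : Fin (m + n) → RatFunc k}, (v, w) ∈ (bendAllRight n c).den ↔
      (fun i => w (layout n m (.inl i)), fun j => w (layout n m (.inr j))) ∈ c.den
  | 0, m, c, v, w => by
    rw [bendAllRight, Subsingleton.elim v (fun i => w (layout 0 m (.inl i)))]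
    rfl
  | n + 1, m, c, v, w => by
    rw [bendAllRight, mem_den_cast, mem_den_bendAllRight, mem_den_bendRight]
    apply iff_of_eq
    congr 2
    ext i : 1
    induction i using Fin.lastCases with
    | last =>
      rw [Fin.snoc_last]
      congr 1
      ext
      simp [layout]
    | cast i =>
      rw [Fin.snoc_castSucc]
      congr 1
      ext
      simp [layout]
      omega

theorem mem_den_bendManyLeft : ∀ {i n m : ℕ} {c : ACirc k n (m + i)}
    {v : Fin (n + i) → RatFunc k} {w : Fin m → RatFunc k}, (v, w) ∈ (bendManyLeft i c).den ↔
      (fun j => v (Fin.castAdd i j), Fin.append w fun j => v (Fin.natAdd n j.rev)) ∈ c.den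
  | 0, n, m, c, v, w => by
    rw [bendManyLeft, Subsingleton.elim (fun j : Fin 0 => v (Fin.natAdd n j.rev)) Fin.elim0,
      Fin.append_elim0]
    rfl
  | i + 1, n, m, c, v, w => by
    rw [bendManyLeft, mem_den_cast, mem_den_bendManyLeft, mem_den_bendLeft]
    apply iff_of_eq
    congr 2
    ext j : 1
    induction j using Fin.lastCases with
    | last =>
      rw [Fin.snoc_last, ← Fin.natAdd_last, Fin.append_right]
      congr 1
      ext
      simp
    | cast j =>
      rw [Fin.snoc_castSucc]
      induction j using Fin.addCases with
      | left j =>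
        rw [Fin.append_left]
        exact (Fin.append_left w _ j).symm
      | right j =>
        rw [Fin.append_right, ← Fin.natAdd_castSucc, Fin.append_right]
        congr 1
        ext
        simp
        omega

/-- A rewiring denotes the same relation with its ports renamed. -/
theorem mem_den_rewire {n m i o : ℕ} {c : ACirc k n m} {e : Fin n ⊕ Fin m ≃ Fin i ⊕ Fin o}
    {v : Fin i → RatFunc k} {w : Fin o → RatFunc k} :
    (v, w) ∈ (c.rewire e).den ↔
      (fun a => Sum.elim v w (e (.inl a)), fun b => Sum.elim v w (e (.inr b))) ∈ c.den := by
  simp only [rewire, mem_den_cast, mem_den_bendManyLeft, mem_den_seq, mem_den_perm,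
    mem_den_bendAllRight]
  have key : ∀ p : Fin i ⊕ Fin o, Fin.append (fun j => w (Fin.cast rfl j))
      (fun j : Fin i => v (Fin.cast (Nat.zero_add i) (Fin.natAdd 0 j.rev))) (layout i o p) =
        Sum.elim v w p := by
    rintro (p | p)
    · simp [layout]
    · simp [layout]
  constructor
  · rintro ⟨u, h₁, h₂⟩
    have hu : ∀ q, u (layout n m q) = Sum.elim v w (e q) := by
      intro q
      rw [← key, h₂]
      simp
    simpa only [hu] using h₁
  · intro h
    refine ⟨fun j => Sum.elim v w (e ((layout n m).symm j)), ?_, fun j => ?_⟩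
    · simpa using h
    · obtain ⟨p, rfl⟩ := (layout i o).surjective j
      rw [key]
      simp

/-- The value `s` is the one which enters the feedback register. -/
theorem mem_den_trace {n m : ℕ} {c : ACirc k (n + 1) (m + 1)} {v : Fin n → RatFunc k}
    {w : Fin m → RatFunc k} : (v, w) ∈ (trace c).den ↔
      ∃ s, ((Fin.snoc v (s * RatFunc.X) : Fin (n + 1) → RatFunc k),
        (Fin.snoc w s : Fin (m + 1) → RatFunc k)) ∈ c.den := by
  simp only [trace, mem_den_seq]
  constructor
  · rintro ⟨u₁, h₁, u₂, h₂, u₃, h₃, h₄⟩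
    obtain ⟨h₅, h₆⟩ := mem_den_idn_par_cup.1 h₁
    obtain ⟨h₇, h₈⟩ := mem_den_par_wire.1 h₂
    obtain ⟨h₉, h₁₀⟩ := mem_den_idn_par_register.1 h₇
    obtain ⟨h₁₁, h₁₂⟩ := mem_den_par_wire.1 h₃
    obtain ⟨h₁₃, h₁₄⟩ := mem_den_idn_par_cap.1 h₄
    refine ⟨u₁ (Fin.last (n + 1)), ?_⟩
    rw [← h₆]
    rwa [(eq_snoc_iff (u := Fin.init u₂)).2 ⟨fun i => ((h₅ i).trans (h₉ i)).symm, h₁₀⟩,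
      (eq_snoc_iff (u := Fin.init u₃)).2 ⟨h₁₃,
        h₁₄.trans (h₁₂.symm.trans (h₈.symm.trans h₆.symm))⟩] at h₁₁
  · rintro ⟨s, h⟩
    exact ⟨Fin.snoc (Fin.snoc v s : Fin (n + 1) → RatFunc k) s,
      mem_den_idn_par_cup.2 (by simp),
      Fin.snoc (Fin.snoc v (s * RatFunc.X) : Fin (n + 1) → RatFunc k) s,
      mem_den_par_wire.2 ⟨mem_den_idn_par_register.2 (by simp), by simp⟩,
      Fin.snoc (Fin.snoc w s : Fin (m + 1) → RatFunc k) s,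
      mem_den_par_wire.2 (by simpa using h), mem_den_idn_par_cap.2 (by simp)⟩

end Denotations

section Homogenisation

variable {k : Type u}

/-! ### Homogenisation of circuits -/

/-- The composition of two circuits which share a parameter, the last left port of both. -/
def homogSeq {n z m : ℕ} (c : ACirc k (n + 1) z) (d : ACirc k (z + 1) m) : ACirc k (n + 1) m :=
  .seq (.par (idn n) (.gen .copy)) (.seq (.par (n := n + 1) c .wire) d)

/-- The monoidal product of two circuits which share a parameter, the last left port of both. -/
def homogPar {n m r z : ℕ} (c : ACirc k (n + 1) m) (d : ACirc k (r + 1) z) :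
    ACirc k (n + r + 1) (m + z) :=
  .seq (.par (idn (n + r)) (.gen .copy))
    (.seq (.par (n := n) (m := n) (idn n) (lastToFirst (r + 1)))
      (cast (by omega) rfl (.par c d)))

/-- A circuit with one more left port, the last one, which takes the place of every occurrence of
the generator `one` and of its reflection. -/
def homog : {n m : ℕ} → ACirc k n m → ACirc k (n + 1) m
  | _, _, .gen g => genReplaceOne g
  | _, _, .coGen .one => cap
  | _, _, .coGen g => .par (z := 0) (.coGen g) (.gen .delete)
  | _, _, .empty => .par .empty (.gen .delete)
  | _, _, .wire => .par .wire (.gen .delete)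
  | _, _, .sym => .par .sym (.gen .delete)
  | _, _, .seq c d => homogSeq c.homog d.homog
  | _, _, .par c d => homogPar c.homog d.homog

theorem oneCount_idn : ∀ n : ℕ, (idn n : ACirc k n n).oneCount = 0
  | 0 => rfl
  | n + 1 => by rw [idn, oneCount, oneCount_idn]; rfl

theorem coOneCount_idn : ∀ n : ℕ, (idn n : ACirc k n n).coOneCount = 0
  | 0 => rfl
  | n + 1 => by rw [idn, coOneCount, coOneCount_idn]; rfl

theorem isLinear_iff : ∀ {n m : ℕ} {c : ACirc k n m},
    c.IsLinear ↔ c.oneCount = 0 ∧ c.coOneCount = 0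
  | _, _, .gen g => by simp [IsLinear, oneCount, coOneCount]
  | _, _, .coGen g => by simp [IsLinear, oneCount, coOneCount]
  | _, _, .empty => by simp [IsLinear, oneCount, coOneCount]
  | _, _, .wire => by simp [IsLinear, oneCount, coOneCount]
  | _, _, .sym => by simp [IsLinear, oneCount, coOneCount]
  | _, _, .seq c d => by
    simp only [IsLinear, oneCount, coOneCount, isLinear_iff (c := c), isLinear_iff (c := d)]
    omega
  | _, _, .par c d => by
    simp only [IsLinear, oneCount, coOneCount, isLinear_iff (c := c), isLinear_iff (c := d)]
    omega

theorem isLinear_idn (n : ℕ) : (idn n : ACirc k n n).IsLinear :=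
  isLinear_iff.2 ⟨oneCount_idn n, coOneCount_idn n⟩

theorem IsLinear.cast {n m n' m' : ℕ} {c : ACirc k n m} (h : c.IsLinear) (hn : n = n')
    (hm : m = m') : (cast hn hm c).IsLinear := by
  subst hn hm
  exact h

theorem isLinear_lastToFirst : ∀ r : ℕ, (lastToFirst r : ACirc k (r + 1) (1 + r)).IsLinear
  | 0 => trivial
  | r + 1 => ⟨⟨isLinear_idn r, trivial⟩, isLinear_lastToFirst r, trivial⟩

theorem isLinear_cap : (cap : ACirc k 2 0).IsLinear := ⟨rfl, rfl⟩

theorem isLinear_cup : (cup : ACirc k 0 2).IsLinear := ⟨rfl, rfl⟩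

theorem isLinear_genReplaceOne {n m : ℕ} (g : Gen k n m) : (genReplaceOne g).IsLinear := by
  cases g <;> trivial

theorem isLinear_homog : ∀ {n m : ℕ} (c : ACirc k n m), c.homog.IsLinear
  | _, _, .gen g => isLinear_genReplaceOne g
  | _, _, .coGen g => by cases g <;> first | exact isLinear_cap | exact ⟨rfl, rfl⟩
  | _, _, .empty => ⟨trivial, rfl⟩
  | _, _, .wire => ⟨trivial, rfl⟩
  | _, _, .sym => ⟨trivial, rfl⟩
  | _, _, .seq c d => ⟨⟨isLinear_idn _, rfl⟩, ⟨isLinear_homog c, trivial⟩, isLinear_homog d⟩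
  | _, _, .par c d => ⟨⟨isLinear_idn _, rfl⟩,
      ⟨isLinear_idn _, isLinear_lastToFirst _⟩,
      IsLinear.cast (c := par c.homog d.homog) ⟨isLinear_homog c, isLinear_homog d⟩ _ _⟩

theorem isLinear_replaceOne : ∀ {n m : ℕ} {c : ACirc k n m}, c.oneCount = 1 → c.coOneCount = 0 →
    c.replaceOne.IsLinear
  | _, _, .gen g, _, _ => isLinear_genReplaceOne g
  | _, _, .coGen g, h, _ => by simp [oneCount] at h
  | _, _, .empty, h, _ => by simp [oneCount] at h
  | _, _, .wire, h, _ => by simp [oneCount] at h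
  | _, _, .sym, h, _ => by simp [oneCount] at h
  | _, _, .seq c d, h, h' => by
    simp only [oneCount, coOneCount] at h h'
    rw [replaceOne]
    split_ifs with hc
    · exact ⟨isLinear_replaceOne hc (by omega), isLinear_iff.2 (by omega)⟩
    · exact ⟨⟨isLinear_iff.2 (by omega), trivial⟩,
        isLinear_replaceOne (by omega) (by omega)⟩
  | _, _, .par (n := n) (r := r) c d, h, h' => by
    simp only [oneCount, coOneCount] at h h'
    rw [replaceOne]
    split_ifs with hc
    · exact ⟨⟨isLinear_idn _, isLinear_lastToFirst _⟩,
        IsLinear.cast (c := par c.replaceOne d)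
          ⟨isLinear_replaceOne hc (by omega), isLinear_iff.2 (by omega)⟩ _ _⟩
    · exact ⟨isLinear_iff.2 (by omega), isLinear_replaceOne (by omega) (by omega)⟩

end Homogenisation

section Slices

variable {k : Type u} [Field k]

/-! ### Slices of homogenised relations -/

theorem mem_den_idn_par_copy {n : ℕ} {v : Fin (n + 1) → RatFunc k} {w : Fin (n + 2) → RatFunc k} :
    (v, w) ∈ (par (idn n) (gen .copy)).den ↔
      w = Fin.snoc (α := fun _ => RatFunc k) v (v (Fin.last n)) := by
  rw [mem_den_idn_par, mem_den_copy, eq_snoc_iff]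
  constructor
  · rintro ⟨h₁, h₂, h₃⟩
    refine ⟨fun i => ?_, h₃⟩
    induction i using Fin.lastCases with
    | last => exact h₂
    | cast i => exact (h₁ i).symm
  · rintro ⟨h₁, h₂⟩
    exact ⟨fun i => (h₁ i.castSucc).symm, h₁ (Fin.last n), h₂⟩

theorem mem_den_idn_par_one {n : ℕ} {v : Fin n → RatFunc k} {w : Fin (n + 1) → RatFunc k} :
    (v, w) ∈ (par (n := n) (m := n) (idn n) (gen .one)).den ↔
      w = Fin.snoc (α := fun _ => RatFunc k) v 1 := by
  refine mem_den_idn_par.trans ?_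
  rw [mem_den_one, eq_snoc_iff]
  exact and_congr_left' (forall_congr' fun i => eq_comm)

theorem mem_den_homogSeq {n z m : ℕ} {c : ACirc k (n + 1) z} {d : ACirc k (z + 1) m}
    {v : Fin n → RatFunc k} {p : RatFunc k} {w : Fin m → RatFunc k} :
    ((Fin.snoc v p : Fin (n + 1) → RatFunc k), w) ∈ (homogSeq c d).den ↔
      ∃ u, ((Fin.snoc v p : Fin (n + 1) → RatFunc k), u) ∈ c.den ∧
        ((Fin.snoc u p : Fin (z + 1) → RatFunc k), w) ∈ d.den := by
  simp only [homogSeq, mem_den_seq, mem_den_idn_par_copy, exists_eq_left, mem_den_par_wire,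
    Fin.init_snoc, Fin.snoc_last]
  constructor
  · rintro ⟨u, ⟨h₁, h₂⟩, h₃⟩
    refine ⟨Fin.init u, h₁, ?_⟩
    rwa [h₂, Fin.snoc_init_self]
  · rintro ⟨u, h₁, h₂⟩
    exact ⟨Fin.snoc u p, by simpa using h₁, h₂⟩

theorem snoc_comp_castAdd {n r : ℕ} {K : Type*} (v : Fin (n + r) → K) (p : K) :
    (fun i => (Fin.snoc v p : Fin (n + (r + 1)) → K) (Fin.castAdd (r + 1) i)) =
      fun i => v (Fin.castAdd r i) :=
  funext fun i => Fin.snoc_castSucc (α := fun _ => K) p v (Fin.castAdd r i)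

theorem snoc_comp_natAdd {n r : ℕ} {K : Type*} (v : Fin (n + r) → K) (p : K) :
    (fun i => (Fin.snoc v p : Fin (n + (r + 1)) → K) (Fin.natAdd n i)) =
      (Fin.snoc (fun i => v (Fin.natAdd n i)) p : Fin (r + 1) → K) :=
  eq_snoc_iff.2 ⟨fun i => Fin.snoc_castSucc (α := fun _ => K) p v (Fin.natAdd n i),
    Fin.snoc_last (α := fun _ => K) p v⟩

/-- Wires to a monoidal product in which the last of the left ports is fed to the last left port
of the first factor. -/
theorem mem_den_seq_lastToFirst {n m r z : ℕ} {c : ACirc k (n + 1) m} {d : ACirc k r z}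
    (h : n + 1 + r = n + (1 + r)) {v : Fin (n + r) → RatFunc k} {p : RatFunc k}
    {w : Fin (m + z) → RatFunc k} :
    ((Fin.snoc v p : Fin (n + r + 1) → RatFunc k), w) ∈
        (seq (par (n := n) (m := n) (idn n) (lastToFirst r)) (cast h rfl (par c d))).den ↔
      ((Fin.snoc (fun i => v (Fin.castAdd r i)) p : Fin (n + 1) → RatFunc k),
        fun j => w (Fin.castAdd z j)) ∈ c.den ∧
      (fun i => v (Fin.natAdd n i), fun j => w (Fin.natAdd m j)) ∈ d.den := by
  rw [mem_den_seq]
  constructor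
  · rintro ⟨u, h₁, h₂⟩
    obtain ⟨h₃, h₄⟩ := mem_den_idn_par.1 h₁
    obtain ⟨h₅, h₆⟩ := mem_den_lastToFirst.1 h₄
    obtain ⟨h₇, h₈⟩ := mem_den_par.1 (mem_den_cast.1 h₂)
    have hc : (fun i => u (Fin.cast h (Fin.castAdd r i))) =
        (Fin.snoc (fun i => v (Fin.castAdd r i)) p : Fin (n + 1) → RatFunc k) :=
      eq_snoc_iff.2 ⟨fun i => (h₃ i).symm.trans
        (Fin.snoc_castSucc (α := fun _ => RatFunc k) p v (Fin.castAdd r i)),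
        h₅.trans (Fin.snoc_last (α := fun _ => RatFunc k) p v)⟩
    have hd : (fun i => u (Fin.cast h (Fin.natAdd (n + 1) i))) = fun i => v (Fin.natAdd n i) := by
      ext i : 1
      refine Eq.trans (congrArg u (Fin.ext ?_)) ((h₆ i).trans
        (Fin.snoc_castSucc (α := fun _ => RatFunc k) p v (Fin.natAdd n i)))
      simp
      omega
    exact ⟨hc ▸ h₇, hd ▸ h₈⟩
  · rintro ⟨h₁, h₂⟩
    refine ⟨fun i => Fin.append
      (Fin.snoc (fun i => v (Fin.castAdd r i)) p : Fin (n + 1) → RatFunc k)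
      (fun i => v (Fin.natAdd n i)) (Fin.cast h.symm i), mem_den_idn_par.2 ⟨fun i => ?_,
      mem_den_lastToFirst.2 ⟨?_, fun i => ?_⟩⟩, mem_den_cast.2 (mem_den_par.2 ?_)⟩
    · have h₃ : Fin.cast h.symm (Fin.castAdd (1 + r) i) = Fin.castAdd r i.castSucc := rfl
      rw [h₃, Fin.append_left, Fin.snoc_castSucc]
      exact Fin.snoc_castSucc (α := fun _ => RatFunc k) p v (Fin.castAdd r i)
    · have h₃ : Fin.cast h.symm (Fin.natAdd n (Fin.castAdd r 0)) = Fin.castAdd r (Fin.last n) := rfl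
      rw [h₃, Fin.append_left, Fin.snoc_last]
      exact (Fin.snoc_last (α := fun _ => RatFunc k) p v).symm
    · have h₃ : Fin.cast h.symm (Fin.natAdd n (Fin.natAdd 1 i)) = Fin.natAdd (n + 1) i := by
        ext
        simp
        omega
      rw [h₃, Fin.append_right]
      exact (Fin.snoc_castSucc (α := fun _ => RatFunc k) p v (Fin.natAdd n i)).symm
    · simpa using ⟨h₁, h₂⟩

theorem mem_den_homogPar {n m r z : ℕ} {c : ACirc k (n + 1) m} {d : ACirc k (r + 1) z}
    {v : Fin (n + r) → RatFunc k} {p : RatFunc k} {w : Fin (m + z) → RatFunc k} :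
    ((Fin.snoc v p : Fin (n + r + 1) → RatFunc k), w) ∈ (homogPar c d).den ↔
      ((Fin.snoc (fun i => v (Fin.castAdd r i)) p : Fin (n + 1) → RatFunc k),
        fun j => w (Fin.castAdd z j)) ∈ c.den ∧
      ((Fin.snoc (fun i => v (Fin.natAdd n i)) p : Fin (r + 1) → RatFunc k),
        fun j => w (Fin.natAdd m j)) ∈ d.den := by
  rw [homogPar, mem_den_seq]
  simp only [mem_den_idn_par_copy, exists_eq_left, Fin.snoc_last]
  rw [← snoc_comp_natAdd v p, ← snoc_comp_castAdd v p]
  exact mem_den_seq_lastToFirst _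

theorem mem_den_genReplaceOne {n m : ℕ} {g : Gen k n m} {v : Fin n → RatFunc k}
    {w : Fin m → RatFunc k} :
    ((Fin.snoc v 1 : Fin (n + 1) → RatFunc k), w) ∈ (genReplaceOne g).den ↔
      (v, w) ∈ (gen g).den := by
  cases g
  case one =>
    rw [mem_den_one]
    exact mem_den_wire.trans (by rw [← Fin.last_zero, Fin.snoc_last, eq_comm])
  all_goals exact mem_den_par_delete.trans (by rw [Fin.init_snoc])

/-- A circuit denotes the slice of its homogenisation where the parameter is `1`. -/
theorem mem_den_homog : ∀ {n m : ℕ} {c : ACirc k n m} {v : Fin n → RatFunc k}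
    {w : Fin m → RatFunc k}, ((Fin.snoc v 1 : Fin (n + 1) → RatFunc k), w) ∈ c.homog.den ↔
      (v, w) ∈ c.den
  | _, _, .gen g, v, w => mem_den_genReplaceOne
  | _, _, .coGen g, v, w => by
    cases g
    case one =>
      rw [mem_den_coGen, mem_den_one]
      exact mem_den_cap
    all_goals exact mem_den_par_delete.trans (by rw [Fin.init_snoc])
  | _, _, .empty, v, w => mem_den_par_delete.trans (by rw [Fin.init_snoc])
  | _, _, .wire, v, w => mem_den_par_delete.trans (by rw [Fin.init_snoc])
  | _, _, .sym, v, w => mem_den_par_delete.trans (by rw [Fin.init_snoc])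
  | _, _, .seq c d, v, w => by
    simp only [homog, mem_den_homogSeq, mem_den_homog, mem_den_seq]
  | _, _, .par c d, v, w => by
    rw [homog, mem_den_homogPar, mem_den_homog, mem_den_homog, mem_den_par]

/-- A circuit with one `one` denotes the slice, at `1`, of the circuit in which this `one` is
replaced by a port. -/
theorem mem_den_replaceOne : ∀ {n m : ℕ} {c : ACirc k n m}, c.oneCount = 1 →
    ∀ {v : Fin n → RatFunc k} {w : Fin m → RatFunc k},
      (((Fin.snoc v 1 : Fin (n + 1) → RatFunc k), w) ∈ c.replaceOne.den ↔ (v, w) ∈ c.den)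
  | _, _, .gen g, _, _, _ => mem_den_genReplaceOne
  | _, _, .coGen g, h, _, _ => by simp [oneCount] at h
  | _, _, .empty, h, _, _ => by simp [oneCount] at h
  | _, _, .wire, h, _, _ => by simp [oneCount] at h
  | _, _, .sym, h, _, _ => by simp [oneCount] at h
  | _, _, .seq c d, h, v, w => by
    simp only [oneCount] at h
    rw [replaceOne]
    split_ifs with hc
    · simp only [mem_den_seq, mem_den_replaceOne hc]
    · simp only [mem_den_seq, mem_den_par_wire, Fin.init_snoc, Fin.snoc_last]
      constructor
      · rintro ⟨u, ⟨h₁, h₂⟩, h₃⟩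
        rw [← Fin.snoc_init_self u, ← h₂, mem_den_replaceOne (by omega)] at h₃
        exact ⟨_, h₁, h₃⟩
      · rintro ⟨u, h₁, h₂⟩
        exact ⟨Fin.snoc u 1, by simpa using h₁, (mem_den_replaceOne (by omega)).2 h₂⟩
  | _, _, .par (n := n) (r := r) c d, h, v, w => by
    simp only [oneCount] at h
    rw [replaceOne]
    split_ifs with hc
    · rw [mem_den_seq_lastToFirst, mem_den_replaceOne hc, mem_den_par]
    · refine Iff.trans ?_ mem_den_par.symm
      rw [← mem_den_replaceOne (c := d) (by omega)]
      refine mem_den_par.trans ?_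
      rw [snoc_comp_natAdd, snoc_comp_castAdd]

theorem exists_isHat {n m : ℕ} (c : ACirc k n m) : ∃ d : Circ k (n + 1) m, c.IsHat d := by
  let c' : ACirc k n m := seq (par (n := n) (m := n) (idn n) (gen .one)) c.homog
  have hc := isLinear_iff.1 (isLinear_homog c)
  have h₁ : c'.oneCount = 1 := by
    change (idn n).oneCount + 1 + c.homog.oneCount = 1
    rw [oneCount_idn, hc.1]
  have h₂ : c'.coOneCount = 0 := by
    change (idn n).coOneCount + 0 + c.homog.coOneCount = 0
    rw [coOneCount_idn, hc.2]
  refine ⟨⟨c'.replaceOne, isLinear_replaceOne h₁ h₂⟩, c', ?_, h₁, h₂, rfl⟩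
  ext ⟨v, w⟩
  simp only [c', mem_den_seq, mem_den_idn_par_one, exists_eq_left, mem_den_homog]

theorem IsHat.mem_den {n m : ℕ} {c : ACirc k n m} {d : Circ k (n + 1) m} (h : c.IsHat d)
    {v : Fin n → RatFunc k} {w : Fin m → RatFunc k} :
    ((Fin.snoc v 1 : Fin (n + 1) → RatFunc k), w) ∈ d.1.den ↔ (v, w) ∈ c.den := by
  obtain ⟨c', hc, h₁, -, hd⟩ := h
  rw [hd, mem_den_replaceOne h₁, show c.den = c'.den from hc]

end Slices

/-! ### Wirings as signal flow graphs -/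

section SignalFlowGraphs

variable {k : Type u}

theorem IsSF.isASF {n m : ℕ} {c : ACirc k n m} (h : c.IsSF) : c.IsASF := by
  induction h with
  | gen g _ => exact .gen g
  | empty => exact .empty
  | wire => exact .wire
  | sym => exact .sym
  | seq _ _ hc hd => exact .seq hc hd
  | par _ _ hc hd => exact .par hc hd
  | trace _ hc => exact .trace hc

theorem IsSF.isLinear {n m : ℕ} {c : ACirc k n m} (h : c.IsSF) : c.IsLinear := by
  induction h with
  | gen g hg => exact hg
  | empty => trivial
  | wire => trivial
  | sym => trivial
  | seq _ _ hc hd => exact ⟨hc, hd⟩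
  | par _ _ hc hd => exact ⟨hc, hd⟩
  | trace _ hc =>
    exact ⟨⟨isLinear_idn _, isLinear_cup⟩, ⟨⟨isLinear_idn _, rfl⟩, trivial⟩, ⟨hc, trivial⟩,
      isLinear_idn _, isLinear_cap⟩

theorem IsSF.cast {n m n' m' : ℕ} {c : ACirc k n m} (h : c.IsSF) (hn : n = n') (hm : m = m') :
    (cast hn hm c).IsSF := by
  subst hn hm
  exact h

theorem isSF_idn : ∀ n : ℕ, (idn n : ACirc k n n).IsSF
  | 0 => .empty
  | n + 1 => .par (isSF_idn n) .wire

theorem isSF_lastToFirst : ∀ r : ℕ, (lastToFirst r : ACirc k (r + 1) (1 + r)).IsSF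
  | 0 => .wire
  | r + 1 => .seq (.par (isSF_idn r) .sym) (.par (isSF_lastToFirst r) .wire)

theorem isSF_toLast : ∀ (n : ℕ) (i : Fin (n + 1)), (toLast n i : ACirc k (n + 1) (n + 1)).IsSF
  | 0, _ => .wire
  | n + 1, i => by
    induction i using Fin.lastCases with
    | last =>
      rw [toLast, Fin.lastCases_last]
      exact isSF_idn _
    | cast j =>
      rw [toLast, Fin.lastCases_castSucc]
      exact .seq (.par (isSF_toLast n j) .wire) (.par (isSF_idn n) .sym)

theorem isSF_perm : ∀ (n m : ℕ) (σ : Fin m ≃ Fin n), (perm n m σ : ACirc k n m).IsSF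
  | 0, 0, _ => .empty
  | 0, _ + 1, σ => (σ 0).elim0
  | _ + 1, 0, σ => (σ.symm 0).elim0
  | n + 1, m + 1, _ => .seq (isSF_toLast n _) (.par (isSF_perm n m _) .wire)

theorem isSF_genReplaceOne {n m : ℕ} (g : Gen k n m) : (genReplaceOne g).IsSF := by
  cases g
  case one => exact .wire
  all_goals exact .par (.gen _ rfl) (.gen _ rfl)

theorem IsSF.homogSeq {n z m : ℕ} {c : ACirc k (n + 1) z} {d : ACirc k (z + 1) m}
    (hc : c.IsSF) (hd : d.IsSF) : (homogSeq c d).IsSF :=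
  .seq (.par (isSF_idn n) (.gen _ rfl)) (.seq (.par hc .wire) hd)

theorem IsSF.homogPar {n m r z : ℕ} {c : ACirc k (n + 1) m} {d : ACirc k (r + 1) z}
    (hc : c.IsSF) (hd : d.IsSF) : (homogPar c d).IsSF :=
  .seq (.par (isSF_idn (n + r)) (.gen _ rfl))
    (.seq (.par (isSF_idn n) (isSF_lastToFirst (r + 1))) (IsSF.cast (.par hc hd) _ _))

end SignalFlowGraphs

variable {k : Type u} [Field k]

/-! ### Homogenisation of affine signal flow graphs -/

/-- Every affine signal flow graph denotes the slice, at `1`, of a signal flow graph with one more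
left port. -/
theorem IsASF.exists_isSF {n m : ℕ} {g : ACirc k n m} (hg : g.IsASF) :
    ∃ f : ACirc k (n + 1) m, f.IsSF ∧ ∀ (v : Fin n → RatFunc k) (w : Fin m → RatFunc k),
      ((Fin.snoc v 1 : Fin (n + 1) → RatFunc k), w) ∈ f.den ↔ (v, w) ∈ g.den := by
  induction hg with
  | gen g => exact ⟨genReplaceOne g, isSF_genReplaceOne g, fun v w => mem_den_genReplaceOne⟩
  | empty => exact ⟨homog ACirc.empty, .par .empty (.gen _ rfl), fun _ _ => mem_den_homog⟩
  | wire => exact ⟨homog ACirc.wire, .par .wire (.gen _ rfl), fun _ _ => mem_den_homog⟩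
  | sym => exact ⟨homog ACirc.sym, .par .sym (.gen _ rfl), fun _ _ => mem_den_homog⟩
  | seq _ _ hc hd =>
    obtain ⟨c', hc', hc⟩ := hc
    obtain ⟨d', hd', hd⟩ := hd
    refine ⟨homogSeq c' d', hc'.homogSeq hd', fun v w => ?_⟩
    simp only [mem_den_homogSeq, hc, hd, mem_den_seq]
  | par _ _ hc hd =>
    obtain ⟨c', hc', hc⟩ := hc
    obtain ⟨d', hd', hd⟩ := hd
    refine ⟨homogPar c' d', hc'.homogPar hd', fun v w => ?_⟩
    rw [mem_den_homogPar, hc, hd, mem_den_par]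
  | @trace n m c _ hc =>
    obtain ⟨c', hc', hc⟩ := hc
    -- The port of the feedback has to be the last one, hence the crossing.
    refine ⟨ACirc.trace (.seq (.par (n := n) (m := n) (idn n) .sym) c'),
      .trace (.seq (.par (isSF_idn n) .sym) hc'), fun v w => ?_⟩
    rw [mem_den_trace, mem_den_trace]
    refine exists_congr fun s => ?_
    rw [← hc, mem_den_seq]
    constructor
    · rintro ⟨u, h₁, h₂⟩
      obtain ⟨h₃, h₄, h₅⟩ := mem_den_idn_par_sym.1 h₁
      have hu : u = Fin.snoc (Fin.snoc v (s * RatFunc.X) : Fin (n + 1) → RatFunc k) 1 := by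
        refine eq_snoc_iff.2 ⟨fun i => ?_, by simpa using h₅⟩
        induction i using Fin.lastCases with
        | last => simpa using h₄
        | cast i => simpa using (h₃ i).symm
      exact hu ▸ h₂
    · intro h
      exact ⟨_, mem_den_idn_par_sym.2 (by simp), h⟩

/-! ### Affine signal flow graphs denote total relations -/

/-- The rational functions without a pole at `0`. -/
noncomputable abbrev regularAtZero (k : Type u) [Field k] : Subring (RatFunc k) :=
  ((Polynomial.idealX k).valuation (RatFunc k)).integer

theorem algebraMap_mem_regularAtZero (p : Polynomial k) :
    algebraMap (Polynomial k) (RatFunc k) p ∈ regularAtZero k :=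
  (Polynomial.idealX k).valuation_le_one p

theorem X_mem_regularAtZero : (RatFunc.X : RatFunc k) ∈ regularAtZero k := by
  rw [← RatFunc.algebraMap_X]
  exact algebraMap_mem_regularAtZero _

/-- The feedback equation `s = d * (s * X) + b` can be solved, as `1 - X * d` is a unit of the
ring of rational functions without a pole at `0`. -/
theorem exists_one_sub_X_mul_inverse {d : RatFunc k} (hd : d ∈ regularAtZero k) :
    ∃ a ∈ regularAtZero k, a * (1 - RatFunc.X * d) = 1 := by
  set v := (Polynomial.idealX k).valuation (RatFunc k) with hv
  have hX : v RatFunc.X < 1 := by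
    rw [hv, Polynomial.valuation_X_eq_neg_one, ← WithZero.exp_zero, WithZero.exp_lt_exp]
    norm_num
  have h : v (1 - RatFunc.X * d) = 1 := by
    refine Valuation.map_one_sub_of_lt v ?_
    rw [map_mul]
    exact mul_lt_one_of_lt_of_le hX hd
  refine ⟨(1 - RatFunc.X * d)⁻¹, ?_, inv_mul_cancel₀ fun h₀ => ?_⟩
  · change v _ ≤ 1
    rw [map_inv₀, h, inv_one]
  · rw [h₀, map_zero] at h
    exact zero_ne_one h

/-- The affine functions in `n` variables whose coefficients have no pole at `0`. -/
noncomputable def regularAffine (k : Type u) [Field k] (n : ℕ) :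
    Submodule (regularAtZero k) ((Fin n → RatFunc k) → RatFunc k) :=
  Submodule.span _ (insert (fun _ => 1) (Set.range fun i v => v i))

theorem const_one_mem_regularAffine {n : ℕ} :
    (fun _ => 1 : (Fin n → RatFunc k) → RatFunc k) ∈ regularAffine k n :=
  Submodule.subset_span (Set.mem_insert _ _)

theorem coord_mem_regularAffine {n : ℕ} (i : Fin n) :
    (fun v : Fin n → RatFunc k => v i) ∈ regularAffine k n :=
  Submodule.subset_span (Set.mem_insert_of_mem _ ⟨i, rfl⟩)

theorem mul_mem_regularAffine {n : ℕ} {a : RatFunc k} (ha : a ∈ regularAtZero k)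
    {f : (Fin n → RatFunc k) → RatFunc k} (hf : f ∈ regularAffine k n) :
    (fun v => a * f v) ∈ regularAffine k n :=
  Submodule.smul_mem _ (⟨a, ha⟩ : regularAtZero k) hf

theorem comp_mem_regularAffine {n m : ℕ} {f : (Fin n → RatFunc k) → RatFunc k}
    (hf : f ∈ regularAffine k n) {F : (Fin m → RatFunc k) → Fin n → RatFunc k}
    (hF : ∀ i, (fun v => F v i) ∈ regularAffine k m) :
    (fun v => f (F v)) ∈ regularAffine k m := by
  induction hf using Submodule.span_induction with
  | mem f hf =>
    obtain rfl | ⟨i, rfl⟩ := hf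
    · exact const_one_mem_regularAffine
    · exact hF i
  | zero => exact Submodule.zero_mem _
  | add f g _ _ hf hg => exact Submodule.add_mem _ hf hg
  | smul a f _ hf => exact Submodule.smul_mem _ a hf

/-- The last variable of an affine function can be split off. -/
theorem exists_eq_add_mul_of_mem_regularAffine {n : ℕ}
    {f : (Fin (n + 1) → RatFunc k) → RatFunc k}
    (hf : f ∈ regularAffine k (n + 1)) :
    ∃ g ∈ regularAffine k n, ∃ d ∈ regularAtZero k, ∀ (v : Fin n → RatFunc k) (s : RatFunc k),
      f (Fin.snoc v s) = g v + d * s := by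
  induction hf using Submodule.span_induction with
  | mem f hf =>
    obtain rfl | ⟨i, rfl⟩ := hf
    · exact ⟨_, const_one_mem_regularAffine, 0, Subring.zero_mem _, fun v s => by simp⟩
    · induction i using Fin.lastCases with
      | last => exact ⟨_, Submodule.zero_mem _, 1, Subring.one_mem _, fun v s => by simp⟩
      | cast i =>
        exact ⟨_, coord_mem_regularAffine i, 0, Subring.zero_mem _, fun v s => by simp⟩
  | zero => exact ⟨_, Submodule.zero_mem _, 0, Subring.zero_mem _, fun v s => by simp⟩
  | add f g _ _ hf hg =>
    obtain ⟨f', hf', a, ha, hf⟩ := hf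
    obtain ⟨g', hg', b, hb, hg⟩ := hg
    refine ⟨_, Submodule.add_mem _ hf' hg', _, Subring.add_mem _ ha hb, fun v s => ?_⟩
    simp only [Pi.add_apply, hf, hg]
    ring
  | smul c f _ hf =>
    obtain ⟨f', hf', a, ha, hf⟩ := hf
    refine ⟨_, Submodule.smul_mem _ c hf', _, Subring.mul_mem _ c.2 ha, fun v s => ?_⟩
    simp only [Pi.smul_apply, hf, Subring.smul_def, smul_eq_mul]
    ring

/-- An affine signal flow graph relates every input to the output of an affine function without
poles at `0`; the latter property is what makes feedback through a register solvable. -/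
theorem IsASF.exists_regularAffine {n m : ℕ} {g : ACirc k n m} (hg : g.IsASF) :
    ∃ F : (Fin n → RatFunc k) → Fin m → RatFunc k,
      (∀ j, (fun v => F v j) ∈ regularAffine k n) ∧ ∀ v, (v, F v) ∈ g.den := by
  induction hg with
  | gen g =>
    cases g with
    | copy => exact ⟨fun v _ => v 0, fun _ => coord_mem_regularAffine 0,
        fun v => mem_den_copy.2 ⟨rfl, rfl⟩⟩
    | delete => exact ⟨fun _ => ![], fun j => j.elim0, fun v => mem_den_delete⟩
    | scalar r =>
      refine ⟨fun v _ => RatFunc.C r * v 0, fun _ => mul_mem_regularAffine ?_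
        (coord_mem_regularAffine 0), fun v => ⟨v 0, ?_⟩⟩
      · rw [← RatFunc.algebraMap_C]
        exact algebraMap_mem_regularAtZero _
      · refine Prod.ext ?_ ?_ <;> ext i <;> fin_cases i
        · rfl
        · exact mul_comm _ _
    | register =>
      exact ⟨fun v _ => RatFunc.X * v 0, fun _ => mul_mem_regularAffine X_mem_regularAtZero
        (coord_mem_regularAffine 0), fun v => mem_den_register.2 (mul_comm _ _)⟩
    | add =>
      refine ⟨fun v _ => v 0 + v 1, fun _ => Submodule.add_mem _ (coord_mem_regularAffine 0)
        (coord_mem_regularAffine 1), fun v => ⟨(v 0, v 1), ?_⟩⟩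
      refine Prod.ext ?_ ?_ <;> ext i <;> fin_cases i <;> rfl
    | zero =>
      refine ⟨fun _ => 0, fun _ => Submodule.zero_mem _, fun v => ?_⟩
      refine Set.mem_singleton_iff.2 (Prod.ext (Subsingleton.elim _ _) ?_)
      ext i
      fin_cases i
      rfl
    | one => exact ⟨fun _ => 1, fun _ => const_one_mem_regularAffine, fun v => mem_den_one.2 rfl⟩
  | empty => exact ⟨fun v => v, coord_mem_regularAffine, fun v => mem_den_empty⟩
  | wire => exact ⟨fun v => v, coord_mem_regularAffine, fun v => mem_den_wire.2 rfl⟩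
  | sym =>
    exact ⟨fun v i => v (Equiv.swap 0 1 i), fun _ => coord_mem_regularAffine _,
      fun v => mem_den_sym.2 ⟨by simp, by simp⟩⟩
  | seq _ _ hc hd =>
    obtain ⟨F, hF, hc⟩ := hc
    obtain ⟨G, hG, hd⟩ := hd
    exact ⟨fun v => G (F v), fun j => comp_mem_regularAffine (hG j) hF,
      fun v => ⟨F v, hc v, hd _⟩⟩
  | par _ _ hc hd =>
    obtain ⟨F, hF, hc⟩ := hc
    obtain ⟨G, hG, hd⟩ := hd
    refine ⟨fun v => Fin.append (F fun i => v (Fin.castAdd _ i)) (G fun i => v (Fin.natAdd _ i)),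
      fun j => ?_, fun v => mem_den_par.2 ?_⟩
    · induction j using Fin.addCases with
      | left j =>
        simp only [Fin.append_left]
        exact comp_mem_regularAffine (hF j) fun i => coord_mem_regularAffine _
      | right j =>
        simp only [Fin.append_right]
        exact comp_mem_regularAffine (hG j) fun i => coord_mem_regularAffine _
    · simpa only [Fin.append_left, Fin.append_right] using ⟨hc _, hd _⟩
  | @trace n m c _ hc =>
    obtain ⟨F, hF, hc⟩ := hc
    obtain ⟨f, hf, d, hd, hfd⟩ := exists_eq_add_mul_of_mem_regularAffine (hF (Fin.last m))
    obtain ⟨a, ha, had⟩ := exists_one_sub_X_mul_inverse hd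
    let s : (Fin n → RatFunc k) → RatFunc k := fun v => a * f v
    have hs : s ∈ regularAffine k n := mul_mem_regularAffine ha hf
    let G : (Fin n → RatFunc k) → Fin (n + 1) → RatFunc k := fun v =>
      Fin.snoc v (s v * RatFunc.X)
    have hG : ∀ i, (fun v => G v i) ∈ regularAffine k n := by
      intro i
      induction i using Fin.lastCases with
      | last =>
        simp only [G, Fin.snoc_last, mul_comm _ RatFunc.X]
        exact mul_mem_regularAffine X_mem_regularAtZero hs
      | cast i =>
        simp only [G, Fin.snoc_castSucc]
        exact coord_mem_regularAffine i
    -- The input of the register solves `s = f v + d * (s * X)`.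
    refine ⟨fun v => Fin.init (F (G v)), fun j => comp_mem_regularAffine (hF j.castSucc) hG,
      fun v => mem_den_trace.2 ⟨s v, ?_⟩⟩
    have hsv : F (G v) (Fin.last m) = s v := by
      rw [hfd]
      linear_combination (-f v) * had
    rw [← hsv, Fin.snoc_init_self, hsv]
    exact hc _

theorem IsASF.nonempty_den {n m : ℕ} {g : ACirc k n m} (hg : g.IsASF) : g.den.Nonempty :=
  let ⟨_, _, hF⟩ := hg.exists_regularAffine
  ⟨_, hF 0⟩

/-! ### Linear circuits denote linear relations -/

theorem _root_.SignalFlow.Gen.smul_add_mem_den {n m : ℕ} {g : Gen k n m} (h : g.oneCount = 0)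
    (a : RatFunc k) {p q : (Fin n → RatFunc k) × (Fin m → RatFunc k)}
    (hp : p ∈ g.den) (hq : q ∈ g.den) : a • p + q ∈ g.den := by
  cases g with
  | copy | delete =>
    obtain ⟨x, rfl⟩ := hp
    obtain ⟨y, rfl⟩ := hq
    refine ⟨a * x + y, Prod.ext ?_ ?_⟩ <;> ext i <;> fin_cases i <;> rfl
  | scalar | register =>
    obtain ⟨x, rfl⟩ := hp
    obtain ⟨y, rfl⟩ := hq
    refine ⟨a * x + y, Prod.ext ?_ ?_⟩ <;> ext i <;> fin_cases i
    all_goals simp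
    ring
  | add =>
    obtain ⟨x, rfl⟩ := hp
    obtain ⟨y, rfl⟩ := hq
    refine ⟨a • x + y, Prod.ext ?_ ?_⟩ <;> ext i <;> fin_cases i
    all_goals simp
    ring
  | zero =>
    obtain rfl := Set.mem_singleton_iff.1 hp
    obtain rfl := Set.mem_singleton_iff.1 hq
    refine Set.mem_singleton_iff.2 (Prod.ext (Subsingleton.elim _ _) ?_)
    ext i
    fin_cases i
    simp
  | one => exact absurd h one_ne_zero

theorem IsLinear.smul_add_mem_den : ∀ {n m : ℕ} {c : ACirc k n m}, c.IsLinear →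
    ∀ (a : RatFunc k) {p q : (Fin n → RatFunc k) × (Fin m → RatFunc k)},
      p ∈ c.den → q ∈ c.den → a • p + q ∈ c.den
  | _, _, .gen g, h, a, p, q, hp, hq => Gen.smul_add_mem_den h a hp hq
  | _, _, .coGen g, h, a, p, q, hp, hq =>
    Gen.smul_add_mem_den (g := g) h a (p := p.swap) (q := q.swap) hp hq
  | _, _, .empty, _, _, _, _, _, _ => mem_den_empty
  | _, _, .wire, _, a, p, q, hp, hq => by
    have hp := mem_den_wire.1 hp
    have hq := mem_den_wire.1 hq
    exact mem_den_wire.2 (by simp [hp, hq])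
  | _, _, .sym, _, a, p, q, hp, hq => by
    have hp := mem_den_sym.1 hp
    have hq := mem_den_sym.1 hq
    exact mem_den_sym.2 (by simp [hp, hq])
  | _, _, .seq c d, h, a, p, q, hp, hq => by
    obtain ⟨x, hp₁, hp₂⟩ := hp
    obtain ⟨y, hq₁, hq₂⟩ := hq
    exact ⟨a • x + y, h.1.smul_add_mem_den a hp₁ hq₁, h.2.smul_add_mem_den a hp₂ hq₂⟩
  | _, _, .par c d, h, a, p, q, hp, hq => by
    obtain ⟨hp₁, hp₂⟩ := mem_den_par.1 hp
    obtain ⟨hq₁, hq₂⟩ := mem_den_par.1 hq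
    exact mem_den_par.2 ⟨h.1.smul_add_mem_den a hp₁ hq₁, h.2.smul_add_mem_den a hp₂ hq₂⟩

/-- Two linear subsets of a vector space which have the same points on the hyperplane `φ = 1`
are equal as soon as there is such a point: translating by its multiples moves every point to
this hyperplane. -/
theorem eq_of_forall_mem_iff_of_eq_one {K V : Type*} [Field K] [AddCommGroup V] [Module K V]
    {S T : Set V} (hS : ∀ (a : K) {x y}, x ∈ S → y ∈ S → a • x + y ∈ S)
    (hT : ∀ (a : K) {x y}, x ∈ T → y ∈ T → a • x + y ∈ T) (φ : V →ₗ[K] K)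
    (h : ∀ x, φ x = 1 → (x ∈ S ↔ x ∈ T)) {z : V} (hz : z ∈ S) (hz' : φ z = 1) :
    S = T := by
  have key : ∀ {A B : Set V}, (∀ (a : K) {x y}, x ∈ A → y ∈ A → a • x + y ∈ A) →
      (∀ (a : K) {x y}, x ∈ B → y ∈ B → a • x + y ∈ B) → (∀ x, φ x = 1 → (x ∈ A ↔ x ∈ B)) →
      z ∈ A → A ⊆ B := by
    intro A B hA hB h hz x hx
    have hy : (1 - φ x) • z + x ∈ B := (h _ (by simp [hz'])).1 (hA _ hz hx)
    have := hB (-(1 - φ x)) ((h z hz').1 hz) hy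
    rwa [neg_smul, neg_add_cancel_left] at this
  exact (key hS hT h hz).antisymm (key hT hS (fun x hx => (h x hx).symm) ((h z hz').1 hz))

/-! ### Values on the ports -/

/-- The values `q` on the ports of a circuit are related by its denotation. -/
def Holds {n m : ℕ} (c : ACirc k n m) (q : Fin n ⊕ Fin m → RatFunc k) : Prop :=
  (fun i => q (.inl i), fun j => q (.inr j)) ∈ c.den

theorem equivalent_iff {n m : ℕ} {c d : ACirc k n m} :
    c.Equivalent d ↔ ∀ q, c.Holds q ↔ d.Holds q := by
  constructor
  · intro h q
    rw [Holds, show c.den = d.den from h, Holds]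
  · intro h
    ext ⟨v, w⟩
    exact h (Sum.elim v w)

theorem holds_rewire {n m i o : ℕ} {c : ACirc k n m} {e : Fin n ⊕ Fin m ≃ Fin i ⊕ Fin o}
    {q : Fin i ⊕ Fin o → RatFunc k} : (c.rewire e).Holds q ↔ c.Holds (q ∘ e) := by
  have h : Sum.elim (fun i => q (.inl i)) (fun j => q (.inr j)) = q := by
    ext (i | j) <;> rfl
  rw [Holds, mem_den_rewire, h]
  rfl

/-- The ports of the sort `(n, m)` together with a new left port, in position `j`. -/
def insertPort {n m : ℕ} (j : Fin (n + 1)) : Option (Fin n ⊕ Fin m) ≃ Fin (n + 1) ⊕ Fin m where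
  toFun x := x.elim (.inl j) (Sum.map j.succAbove id)
  invFun := Sum.elim (fun i => (finSuccEquiv' j i).map .inl) fun b => some (.inr b)
  left_inv x := by
    obtain _ | a | b := x <;> simp
  right_inv x := by
    obtain a | b := x
    · by_cases h : a = j
      · simp [h]
      · obtain ⟨i, rfl⟩ := Fin.exists_succAbove_eq h
        simp
    · simp

/-- The values `q` on the ports of the sort `(n, m)`, together with the value `1` on a new left
port, in position `j`. -/
noncomputable def insertOne {n m : ℕ} (j : Fin (n + 1)) (q : Fin n ⊕ Fin m → RatFunc k) :
    Fin (n + 1) ⊕ Fin m → RatFunc k :=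
  fun x => ((insertPort j).symm x).elim 1 q

theorem insertOne_insertPort {n m : ℕ} (j : Fin (n + 1)) (q : Fin n ⊕ Fin m → RatFunc k)
    (x : Option (Fin n ⊕ Fin m)) : insertOne j q (insertPort j x) = x.elim 1 q := by
  simp [insertOne]

theorem insertOne_self {n m : ℕ} (j : Fin (n + 1)) (q : Fin n ⊕ Fin m → RatFunc k) :
    insertOne j q (.inl j) = 1 :=
  insertOne_insertPort j q none

theorem insertOne_succAbove {n m : ℕ} (j : Fin (n + 1)) (q : Fin n ⊕ Fin m → RatFunc k)
    (i : Fin n) : insertOne j q (.inl (j.succAbove i)) = q (.inl i) :=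
  insertOne_insertPort j q (some (.inl i))

theorem holds_insertOne_last {n m : ℕ} {c : ACirc k (n + 1) m} {q : Fin n ⊕ Fin m → RatFunc k} :
    c.Holds (insertOne (Fin.last n) q) ↔
      ((Fin.snoc (fun i => q (.inl i)) 1 : Fin (n + 1) → RatFunc k), fun j => q (.inr j)) ∈
        c.den := by
  have h : (fun i => insertOne (Fin.last n) q (.inl i)) =
      (Fin.snoc (fun i => q (.inl i)) 1 : Fin (n + 1) → RatFunc k) :=
    eq_snoc_iff.2 ⟨fun i => by rw [← Fin.succAbove_last, insertOne_succAbove], insertOne_self _ _⟩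
  rw [Holds, h]
  rfl

/-- The left port `j` of a signal flow graph can be connected to the generator `one`. -/
theorem IsSF.exists_isASF_holds_iff {n m : ℕ} {f : ACirc k (n + 1) m} (hf : f.IsSF)
    (j : Fin (n + 1)) : ∃ g : ACirc k n m, g.IsASF ∧
      ∀ q, g.Holds q ↔ f.Holds (insertOne j q) := by
  refine ⟨.seq (.par (n := n) (m := n) (idn n) (.gen .one))
    (.seq (perm (n + 1) (n + 1) ((finSuccEquiv' j).trans finSuccEquivLast.symm)) f),
    .seq (.par (isSF_idn n).isASF (.gen _)) (.seq (isSF_perm _ _ _).isASF hf.isASF), fun q => ?_⟩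
  simp only [Holds, mem_den_seq, mem_den_idn_par_one, exists_eq_left, mem_den_perm, ← funext_iff]
  apply iff_of_eq
  congr 2
  ext i
  by_cases h : i = j
  · subst h
    simp [insertOne_self]
  · obtain ⟨i, rfl⟩ := Fin.exists_succAbove_eq h
    simp [insertOne_succAbove]

theorem IsHat.holds_iff {n m : ℕ} {c : ACirc k n m} {d : Circ k (n + 1) m} (h : c.IsHat d)
    (q : Fin n ⊕ Fin m → RatFunc k) : d.1.Holds (insertOne (Fin.last n) q) ↔ c.Holds q :=
  holds_insertOne_last.trans h.mem_den

/-! ### Realisability -/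

theorem IsHat.isInputPort_of_realisable {n m : ℕ} {c : ACirc k n m} {d : Circ k (n + 1) m}
    (h : c.IsHat d) (hc : c.Realisable) : d.IsInputPort (Sum.inl (Fin.last n)) := by
  obtain ⟨i, o, e, g, hg, he⟩ := hc
  obtain ⟨f, hf, hfg⟩ := hg.exists_isSF
  replace he := equivalent_iff.1 he
  have hcg : ∀ q, c.Holds q ↔ g.Holds (q ∘ e.symm) := by
    intro q
    rw [← he, holds_rewire, Function.comp_assoc, e.symm_comp_self, Function.comp_id]
  let e' : Fin (i + 1) ⊕ Fin o ≃ Fin (n + 1) ⊕ Fin m :=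
    (insertPort (Fin.last i)).symm.trans
      ((Equiv.optionCongr e.symm).trans (insertPort (Fin.last n)))
  have he' : ∀ q : Fin n ⊕ Fin m → RatFunc k,
      insertOne (Fin.last n) q ∘ e' = insertOne (Fin.last i) (q ∘ e.symm) := by
    intro q
    ext x
    obtain ⟨x, rfl⟩ := (insertPort (Fin.last i)).surjective x
    rw [insertOne_insertPort]
    simp only [e', Function.comp_apply, Equiv.trans_apply, Equiv.symm_apply_apply,
      insertOne_insertPort]
    cases x <;> rfl
  have key : ∀ q, d.1.Holds (insertOne (Fin.last n) q) ↔
      (f.rewire e').Holds (insertOne (Fin.last n) q) := by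
    intro q
    rw [h.holds_iff, holds_rewire, he', holds_insertOne_last, hfg, hcg]
    rfl
  have hlin : ∀ (a : RatFunc k) {p q : (Fin (n + 1) → RatFunc k) × (Fin m → RatFunc k)},
      p ∈ (f.rewire e').den → q ∈ (f.rewire e').den → a • p + q ∈ (f.rewire e').den := by
    rintro a ⟨v, w⟩ ⟨v', w'⟩ hp hq
    have := hf.isLinear.smul_add_mem_den a (mem_den_rewire.1 hp) (mem_den_rewire.1 hq)
    refine mem_den_rewire.2 ?_
    convert this using 1
    refine Prod.ext ?_ ?_ <;> ext x
    · rcases h : e' (.inl x) with y | y <;> simp [h]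
    · rcases h : e' (.inr x) with y | y <;> simp [h]
  obtain ⟨⟨v, w⟩, hvw⟩ := hg.nonempty_den
  have hz : c.Holds (Sum.elim v w ∘ e) := by
    rw [hcg, Function.comp_assoc, e.self_comp_symm]
    exact hvw
  refine ⟨i + 1, o, f, e', hf, ?_, Fin.last i, ?_⟩
  · refine eq_of_forall_mem_iff_of_eq_one d.2.smul_add_mem_den hlin
      (LinearMap.proj (Fin.last n) ∘ₗ LinearMap.fst _ _ _) ?_ ((h.holds_iff _).2 hz) ?_
    · rintro ⟨v, w⟩ hv
      have hv' : (Fin.snoc (Fin.init v) 1 : Fin (n + 1) → RatFunc k) = v :=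
        (eq_snoc_iff.2 ⟨fun i => rfl, hv⟩).symm
      have := key (Sum.elim (Fin.init v) w)
      rw [holds_insertOne_last, holds_insertOne_last] at this
      exact hv' ▸ this
    · exact insertOne_self _ _
  · change insertPort _ (Option.map _ ((insertPort _).symm (insertPort (Fin.last i) none))) = _
    rw [Equiv.symm_apply_apply]
    rfl

theorem IsHat.realisable_of_isInputPort {n m : ℕ} {c : ACirc k n m} {d : Circ k (n + 1) m}
    (h : c.IsHat d) (hd : d.IsInputPort (Sum.inl (Fin.last n))) : c.Realisable := by
  obtain ⟨i, o, f, e, hf, hdf, j, hj⟩ := hd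
  obtain _ | i := i
  · exact j.elim0
  obtain ⟨g, hg, hgf⟩ := hf.exists_isASF_holds_iff j
  let E : Option (Fin i ⊕ Fin o) ≃ Option (Fin n ⊕ Fin m) :=
    (insertPort j).trans (e.trans (insertPort (Fin.last n)).symm)
  have hE : E none = none := by
    change (insertPort _).symm (e (.inl j)) = _
    rw [hj]
    exact (insertPort (Fin.last n)).symm_apply_apply none
  have hE' : ∀ x, E (some x) = some (E.removeNone x) := fun x =>
    (Equiv.removeNone_some E (Option.ne_none_iff_exists'.1 fun hx =>
      Option.some_ne_none x (E.injective (hx.trans hE.symm)))).symm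
  have he : ∀ q : Fin n ⊕ Fin m → RatFunc k,
      insertOne (Fin.last n) q ∘ e = insertOne j (q ∘ E.removeNone) := by
    intro q
    ext x
    obtain ⟨x, rfl⟩ := (insertPort j).surjective x
    rw [insertOne_insertPort, Function.comp_apply, insertOne]
    change (E x).elim 1 q = _
    cases x with
    | none => rw [hE]; rfl
    | some x => rw [hE']; rfl
  refine ⟨i, o, E.removeNone.symm, g, hg, equivalent_iff.2 fun q => ?_⟩
  rw [holds_rewire, hgf, ← h.holds_iff, equivalent_iff.1 hdf, holds_rewire, he,
    Function.comp_assoc, Equiv.symm_comp_self, Function.comp_id]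

end ACirc

end SignalFlow

theorem mainTheorem10 {k : Type*} [Field k] {n m : ℕ} (c : SignalFlow.ACirc k n m) :
    (∃ chat : SignalFlow.Circ k (n + 1) m, c.IsHat chat) ∧
    ∀ chat : SignalFlow.Circ k (n + 1) m, c.IsHat chat →
      (c.Realisable ↔ chat.IsInputPort (Sum.inl (Fin.last n))) :=
  ⟨c.exists_isHat, fun _ h => ⟨h.isInputPort_of_realisable, h.realisable_of_isInputPort⟩⟩
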